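/- Let $d\ge 1$ and let $M\subset(0,1)^d$ be a nonempty, open, connected set with smooth boundary. Let $\mu$ be the uniform distribution on $M$ and let $X_1,X_2,\dots$ be i.i.d. with law $\mu$. Let $r_n,\rho_n>0$ with $r_n\to0$, $n r_n^{2d+1}\to\infty$, $\rho_n\to0$ and, for every $\alpha>0$, $r_n=o(\rho_n^\alpha)$ and $n r_n^{2d+1}\rho_n^\alpha\to\infty$. The reach of a set $S\subset\mathbb R^d$, denoted ${\rm reach}(S)$, is the supremum of the $\eta>0$ such that every point within distance $\eta$ of $S$ has a unique closest point in $S$. For each $n$ let $\mathcal R_n$ be a class of open sets $R\subset(0,1)^d$ with ${\rm reach}(\partial R)\ge\rho_n$. Let $G_n$ be the graph on $\{1,\dots,n\}$ with weights $\delta_{ij}=\mathbf 1\{\|X_i-X_j\|\le r_n\}$. For $S\subset\{1,\dots,n\}$ put $\delta(S)=\sum_{i\in S}\sum_{j\ne i}\delta_{ij}$, $\sigma(S)=\sum_{i\in S}\sum_{j\in S^c}\delta_{ij}$ and $h(S;G_n)=\sigma(S)/\min\{\delta(S),\delta(S^c)\}$, with $0/0=\infty$. Let $\omega_d$ be the volume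 of the unit ball of $\mathbb R^d$ and let $\gamma_d=\int_{\|z\|\le1}\max(\langle u,z\rangle,0)\,dz$ for any unit vector $u$. For $R\in\mathcal R_n$ define $$h_n^\ddagger(R)=\frac{\omega_d}{\gamma_d r_n}\,h\big(\{i\le n: X_i\in R\};G_n\big)$$ if both $R$ and $R^c$ contain a ball of radius $\rho_n$ centered at one of $X_1,\dots,X_n$, and $h_n^\ddagger(R)=\infty$ otherwise. Let $R_n\in\mathcal R_n$ be (sample-dependent) sets such that, almost surely, $h_n^\ddagger(R_n)=\min_{R\in\mathcal R_n}h_n^\ddagger(R)$ for all $n$, and let $Q_n=\frac1n\sum_{i=1}^n\mathbf 1_{R_n}(X_i)\,\delta_{X_i}$, where $\delta_x$ is the Dirac mass at $x$. Then, with probability one, the following holds: for every subsequence $(n_k)$ and every Borel set $A_\infty$ such that $R_{n_k}\cap M\to A_\infty$ in $L^1$, that is, $\operatorname{Vol}_d\big((R_{n_k}\cap M)\,\Delta\,A_\infty\big)\to0$, the measures $Q_{n_k}$ converge weakly to $\mathbf 1_{A_\infty}\mu$ as $k\to\infty$. -/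

import Mathlib

open MeasureTheory ProbabilityTheory Filter Topology
open Asymptotics
open scoped NNReal ENNReal

noncomputable section

/-- The Euclidean space `ℝ^d`. -/
abbrev Euc (d : ℕ) : Type := EuclideanSpace ℝ (Fin d)

/-- The open unit cube `(0,1)^d`. -/
def openCube (d : ℕ) : Set (Euc d) := {x | ∀ i, x i ∈ Set.Ioo (0 : ℝ) 1}

/-- A set `M` has smooth boundary if near each of its boundary points it is the strict sublevel set
`{g < 0}` of a smooth function `g` whose differential does not vanish at the point. -/
def HasSmoothBoundary {d : ℕ} (M : Set (Euc d)) : Prop :=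
  ∀ p ∈ frontier M, ∃ U : Set (Euc d), IsOpen U ∧ p ∈ U ∧ ∃ g : Euc d → ℝ,
    ContDiffOn ℝ ((⊤ : ℕ∞) : WithTop ℕ∞) g U ∧ fderiv ℝ g p ≠ 0 ∧ M ∩ U = {x ∈ U | g x < 0}

/-- The reach of `S`: the supremum of the `η > 0` such that each point within distance `η` of `S`
has a unique closest point in `S` (so the reach of the empty set is `∞`). -/
def reach {d : ℕ} (S : Set (Euc d)) : ℝ≥0∞ :=
  ⨆ (η : ℝ≥0) (_ : 0 < η ∧ ∀ x : Euc d, Metric.infEDist x S ≤ η →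
    ∃! s, s ∈ S ∧ edist x s = Metric.infEDist x S), (η : ℝ≥0∞)

/-- `ω_d`, the volume of the unit ball. -/
def omegaConst (d : ℕ) : ℝ := (volume (Metric.ball (0 : Euc d) 1)).toReal

/-- `γ_d = ∫ max(⟨u, z⟩, 0) 1{‖z‖ ≤ 1} dz`, with the unit vector `u = e₁`
(all unit vectors give the same value). -/
def gammaConst (d : ℕ) [NeZero d] : ℝ :=
  ∫ z in Metric.closedBall (0 : Euc d) 1,
    max (inner ℝ (EuclideanSpace.single (0 : Fin d) (1 : ℝ)) z) 0

section Graph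

variable {ι : Type*} [Fintype ι] [DecidableEq ι]

/-- Discrete volume `δ(S) = ∑_{i ∈ S} ∑_{j ≠ i} w i j` in the graph with weights `w`. -/
def discreteVolume (w : ι → ι → ℝ≥0) (S : Finset ι) : ℝ≥0 :=
  ∑ i ∈ S, ∑ j ∈ Finset.univ.erase i, w i j

/-- Discrete perimeter `σ(S) = ∑_{i ∈ S} ∑_{j ∈ Sᶜ} w i j`. -/
def discretePerimeter (w : ι → ι → ℝ≥0) (S : Finset ι) : ℝ≥0 :=
  ∑ i ∈ S, ∑ j ∈ Sᶜ, w i j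

/-- Normalized cut `h(S) = σ(S) / min (δ(S), δ(Sᶜ))`, with `0/0 = ∞`. -/
def normalizedCut (w : ι → ι → ℝ≥0) (S : Finset ι) : ℝ≥0∞ :=
  if min (discreteVolume w S) (discreteVolume w Sᶜ) = 0 then ⊤
  else (discretePerimeter w S : ℝ≥0∞) / (min (discreteVolume w S) (discreteVolume w Sᶜ) : ℝ≥0)

end Graph

/-- Weights `1{‖x_i - x_j‖ ≤ r}` of the neighborhood graph on the points `x_i`. -/
def neighborWeight {d n : ℕ} (x : Fin n → Euc d) (r : ℝ) (i j : Fin n) : ℝ≥0 :=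
  open scoped Classical in if ‖x i - x j‖ ≤ r then 1 else 0

/-- The (indices of the) sample points that lie in `R`. -/
def sampleIn {d n : ℕ} (x : Fin n → Euc d) (R : Set (Euc d)) : Finset (Fin n) :=
  open scoped Classical in Finset.univ.filter fun i => x i ∈ R

/-- The functional `h_n^‡(R)` for the sample `x`, connectivity radius `r` and ball radius `ρ`. -/
def penalizedCut {d n : ℕ} [NeZero d] (x : Fin n → Euc d) (r ρ : ℝ) (R : Set (Euc d)) : ℝ≥0∞ :=
  open scoped Classical in
  if (∃ i, Metric.ball (x i) ρ ⊆ R) ∧ (∃ i, Metric.ball (x i) ρ ⊆ Rᶜ) then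
    ENNReal.ofReal (omegaConst d / (gammaConst d * r)) *
      normalizedCut (neighborWeight x r) (sampleIn x R)
  else ⊤

/-- The uniform distribution on `M`: `A ↦ Vol (A ∩ M) / Vol M`. -/
def uniformMeasure {d : ℕ} (M : Set (Euc d)) : FiniteMeasure (Euc d) :=
  ⟨(volume : Measure (Euc d))[|M], inferInstance⟩

/-- The Dirac mass at `x`, as a finite measure. -/
def diracMass {d : ℕ} (x : Euc d) : FiniteMeasure (Euc d) := ⟨Measure.dirac x, inferInstance⟩

/-- The discrete measure `(1/n) ∑_i 1_R(x_i) δ_{x_i}`. -/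
def discreteMeasure {d n : ℕ} (x : Fin n → Euc d) (R : Set (Euc d)) : FiniteMeasure (Euc d) :=
  (n : ℝ≥0)⁻¹ • ∑ i, R.indicator (fun _ => (1 : ℝ≥0)) (x i) • diracMass (x i)

end

/-! The core is a uniform law of large numbers: almost surely, for every bounded continuous `f`, the
integrals of `f` over `R n ω` against the empirical measure and against `μ` approach each other,
however the sets depend on the sample. The `L¹` convergence then identifies the limit of the
`μ`-integrals.

Uniformity over the sets comes from a grid of roughly `n ^ (1/8)` cells. Hoeffding and
Borel–Cantelli make the empirical measure close to `μ` on all cells at once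
(`ae_eventually_forall_abs_empiricalMeasure_sub_lt`). On a cell that misses the boundary of the set,
the indicator is constant and `f` nearly so; the other cells only matter through their proportion
(`abs_integral_sub_integral_le`).

That proportion vanishes because a boundary of positive reach is porous
(`exists_dist_lt_infDist_ge`): below the scale of the reach, each cell has a child that misses it,
so each refinement multiplies the proportion by at most `1 - b⁻ᵈ` (`card_gridMeeting_le`). As `ρ n`
decays more slowly than any power of `n`, any fixed number of refinements eventually fits between `ρ
n` and the cell size. -/

/-! ### Porosity of sets of positive reach -/

/-- If the points within distance `s` of a closed set `Γ` with empty interior have at most one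
closest point in `Γ`, then `Γ` is porous at scale `s`. -/
theorem exists_dist_lt_infDist_ge {E : Type*} [NormedAddCommGroup E] [InnerProductSpace ℝ E]
    [ProperSpace E] {Γ : Set E} (hc : IsClosed Γ) (hne : Γ.Nonempty) (hint : interior Γ = ∅)
    {s : ℝ} (hs : 0 < s)
    (huniq : ∀ x, Metric.infDist x Γ ≤ s → ∀ a ∈ Γ, ∀ b ∈ Γ, dist x a = Metric.infDist x Γ →
      dist x b = Metric.infDist x Γ → a = b) (c : E) :
    ∃ x, dist x c < 2 * s ∧ s / 4 ≤ Metric.infDist x Γ := by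
  by_cases hcs : s / 4 ≤ Metric.infDist c Γ
  · exact ⟨c, by simpa using hs, hcs⟩
  obtain ⟨p, hp, hcp⟩ := (Metric.infDist_lt_iff hne).1 (not_le.1 hcs)
  obtain ⟨x₀, hx₀, hx₀p⟩ : ∃ x₀, x₀ ∉ Γ ∧ dist x₀ p < s / 4 := by
    have hpi : p ∉ interior Γ := by simp [hint]
    rw [mem_interior_iff_mem_nhds, Metric.mem_nhds_iff] at hpi
    push Not at hpi
    obtain ⟨y, hy, hyΓ⟩ := Set.not_subset.1 (hpi (s / 4) (by positivity))
    exact ⟨y, hyΓ, hy⟩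
  have hx₀pos : 0 < Metric.infDist x₀ Γ := (hc.notMem_iff_infDist_pos hne).1 hx₀
  -- Maximizing the distance to `Γ` with a penalty of slope `1/2` replaces a gradient flow: off `Γ`,
  -- unique closest points force this distance to grow at unit speed away from the closest point,
  -- which an interior maximum excludes.
  have hcont : Continuous fun x => Metric.infDist x Γ - dist x x₀ / 2 := by
    have := Metric.continuous_infDist_pt Γ
    fun_prop
  obtain ⟨x, hxB, hxmax⟩ := (isCompact_closedBall x₀ (s / 2)).exists_isMaxOn
    ⟨x₀, by simp; positivity⟩ hcont.continuousOn
  have hx0 : Metric.infDist x₀ Γ ≤ Metric.infDist x Γ - dist x x₀ / 2 := by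
    simpa using hxmax (show x₀ ∈ Metric.closedBall x₀ (s / 2) by simp; positivity)
  have hxc : dist x c < 2 * s := by
    have h1 := dist_triangle x x₀ c
    have h2 := dist_triangle x₀ p c
    rw [dist_comm p c] at h2
    have h3 : dist x x₀ ≤ s / 2 := hxB
    linarith
  by_contra hcon
  push Not at hcon
  have hlt := hcon x hxc
  -- By `hx0`, `dist x x₀ / 2` is less than the distance from `x` to `Γ`, itself below `s / 4`; so
  -- the maximizer is interior and can be moved along `v`.
  have hxx₀ : dist x x₀ < s / 2 := by linarith
  obtain ⟨a, ha, hxa⟩ := hc.exists_infDist_eq_dist hne x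
  set δ := Metric.infDist x Γ with hδ
  have hδpos : 0 < δ := by have := dist_nonneg (x := x) (y := x₀); linarith
  set v := δ⁻¹ • (x - a) with hv
  have hxan : ‖x - a‖ = δ := by rw [← dist_eq_norm, hxa]
  have hvn : ‖v‖ = 1 := by
    rw [hv, norm_smul, hxan, norm_inv, Real.norm_of_nonneg hδpos.le, inv_mul_cancel₀ hδpos.ne']
  let t : ℕ → ℝ := fun k => (s / 2 - dist x x₀) / (k + 1)
  have htpos : ∀ k, 0 < t k := fun k => div_pos (by linarith) (by positivity)
  have htle : ∀ k, t k ≤ s / 2 - dist x x₀ := fun k =>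
    div_le_self (by linarith) (by have := Nat.cast_nonneg (α := ℝ) k; linarith)
  have htlim : Tendsto t atTop (𝓝 0) := by
    simpa [t, div_eq_mul_inv] using
      (tendsto_one_div_add_atTop_nhds_zero_nat (𝕜 := ℝ)).const_mul (s / 2 - dist x x₀)
  choose a' ha' hxa' using fun k => hc.exists_infDist_eq_dist hne (x + t k • v)
  have hstep : ∀ k, dist (x + t k • v) x = t k := fun k => by
    simp [dist_eq_norm, norm_smul, hvn, abs_of_pos (htpos k)]
  have hclose : ∀ k, dist (x + t k • v) (a' k) ≤ δ + t k / 2 := fun k => by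
    have htri := dist_triangle (x + t k • v) x x₀
    rw [hstep k] at htri
    have := hxmax (show x + t k • v ∈ Metric.closedBall x₀ (s / 2) by
      have := htle k
      simp only [Metric.mem_closedBall]; linarith)
    simp only [Set.mem_ofPred_eq] at this
    rw [← hxa']
    linarith
  -- Maximality lets the distance grow by at most `t k / 2` along a step `t k • v`; expanding the
  -- square turns this into a bound on the inner product.
  have hinner : ∀ k, inner ℝ v (x - a' k) ≤ δ / 2 := fun k => by
    have h1 : δ ≤ ‖x - a' k‖ := by
      rw [← dist_eq_norm]; exact Metric.infDist_le_dist_of_mem (ha' k)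
    have h2 := hclose k
    rw [dist_eq_norm, show x + t k • v - a' k = t k • v + (x - a' k) by abel] at h2
    have h3 := norm_add_sq_real (t k • v) (x - a' k)
    rw [norm_smul, hvn, inner_smul_left, Real.norm_of_nonneg (htpos k).le] at h3
    simp only [conj_trivial, mul_one] at h3
    have h4 : ‖t k • v + (x - a' k)‖ ^ 2 ≤ (δ + t k / 2) ^ 2 :=
      pow_le_pow_left₀ (norm_nonneg _) h2 2
    have h5 : δ ^ 2 ≤ ‖x - a' k‖ ^ 2 := pow_le_pow_left₀ hδpos.le h1 2
    have h6 : 2 * (t k * inner ℝ v (x - a' k)) ≤ t k * δ := by nlinarith [sq_nonneg (t k)]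
    have := htpos k
    by_contra hcon'
    push Not at hcon'
    nlinarith
  have hbdd : ∀ k, a' k ∈ Metric.closedBall x (δ + 2 * s) := fun k => by
    have h1 := dist_triangle (a' k) (x + t k • v) x
    rw [hstep k, dist_comm (a' k) (x + t k • v)] at h1
    have := htle k
    have := hclose k
    have := dist_nonneg (x := x) (y := x₀)
    simp only [Metric.mem_closedBall]; linarith
  obtain ⟨a₁, -, ψ, hψ, hlim⟩ := (isCompact_closedBall x (δ + 2 * s)).tendsto_subseq hbdd
  have ha₁ : a₁ ∈ Γ := hc.mem_of_tendsto hlim (Eventually.of_forall fun k => ha' _)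
  have htψ := htlim.comp hψ.tendsto_atTop
  have hxa₁ : dist x a₁ ≤ δ := by
    have hl : Tendsto (fun k => dist (x + t (ψ k) • v) (a' (ψ k))) atTop
        (𝓝 (dist (x + (0 : ℝ) • v) a₁)) :=
      (tendsto_const_nhds.add (htψ.smul_const v)).dist hlim
    have hr : Tendsto (fun k => δ + t (ψ k) / 2) atTop (𝓝 (δ + 0 / 2)) :=
      tendsto_const_nhds.add (htψ.div_const 2)
    simpa using le_of_tendsto_of_tendsto' hl hr fun k => hclose _
  have hin₁ : inner ℝ v (x - a₁) ≤ δ / 2 := by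
    have hl : Tendsto (fun k => inner ℝ v (x - a' (ψ k))) atTop (𝓝 (inner ℝ v (x - a₁))) :=
      tendsto_const_nhds.inner (tendsto_const_nhds.sub hlim)
    exact le_of_tendsto' hl fun k => hinner _
  -- The limit `a₁` is also closest to `x`, hence equals `a`; but `inner ℝ v (x - a) = δ`, against
  -- `hin₁`.
  have heq : a₁ = a := huniq x (by linarith) a₁ ha₁ a ha
    (le_antisymm hxa₁ (Metric.infDist_le_dist_of_mem ha₁)) hxa.symm
  rw [heq, hv, inner_smul_left, real_inner_self_eq_norm_sq, hxan] at hin₁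
  simp only [conj_trivial] at hin₁
  have : δ⁻¹ * δ ^ 2 = δ := by field_simp
  linarith

/-- Porosity at scales below the reach. -/
theorem exists_dist_lt_infDist_ge_of_lt_reach {d : ℕ} {Γ : Set (Euc d)} (hc : IsClosed Γ)
    (hne : Γ.Nonempty) (hint : interior Γ = ∅) {s : ℝ} (hs : 0 < s)
    (hreach : ENNReal.ofReal s < reach Γ) (c : Euc d) :
    ∃ x, dist x c < 2 * s ∧ s / 4 ≤ Metric.infDist x Γ := by
  refine exists_dist_lt_infDist_ge hc hne hint hs (fun x hx a ha b hb hxa hxb => ?_) c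
  simp only [reach, lt_iSup_iff] at hreach
  obtain ⟨η, ⟨-, hη⟩, hsη⟩ := hreach
  have hed : ∀ y, dist x y = Metric.infDist x Γ → edist x y = Metric.infEDist x Γ := fun y hy => by
    rw [edist_dist, hy, Metric.infDist, ENNReal.ofReal_toReal (Metric.infEDist_ne_top hne)]
  refine (hη x ?_).unique ⟨ha, hed a hxa⟩ ⟨hb, hed b hxb⟩
  refine le_trans ?_ hsη.le
  rw [← ENNReal.ofReal_toReal (Metric.infEDist_ne_top hne)]
  exact ENNReal.ofReal_le_ofReal hx

/-! ### Grid cells and the number of them that meet a porous set -/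

/-- The half-open cube of side `b⁻ᵐ` with lower corner `b⁻ᵐ z`. -/
def gridCell {d : ℕ} (b m : ℕ) (z : Fin d → ℤ) : Set (Euc d) :=
  {x | ∀ i, ⌊(b : ℝ) ^ m * x i⌋ = z i}

/-- The indices of the grid cells that make up the unit cube. -/
noncomputable def gridIndices (d b m : ℕ) : Finset (Fin d → ℤ) :=
  Fintype.piFinset fun _ => Finset.Ico 0 ((b : ℤ) ^ m)

/-- The indices of the grid cells in the unit cube that meet `Γ`. -/
noncomputable def gridMeeting {d : ℕ} (b m : ℕ) (Γ : Set (Euc d)) : Finset (Fin d → ℤ) :=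
  open scoped Classical in (gridIndices d b m).filter fun z => (gridCell b m z ∩ Γ).Nonempty

theorem card_gridIndices (d b m : ℕ) : (gridIndices d b m).card = (b ^ m) ^ d := by
  have : ((b : ℤ) ^ m).toNat = b ^ m := by
    rw [← Nat.cast_pow, Int.toNat_natCast]
  simp [gridIndices, Fintype.card_piFinset, this]

theorem mem_gridIndices {d b m : ℕ} {z : Fin d → ℤ} :
    z ∈ gridIndices d b m ↔ ∀ i, 0 ≤ z i ∧ z i < (b : ℤ) ^ m := by
  simp [gridIndices, Fintype.mem_piFinset]

theorem floor_mem_gridIndices {d b m : ℕ} {x : Euc d} (hb : 0 < b) (hx : x ∈ openCube d) :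
    (fun i => ⌊(b : ℝ) ^ m * x i⌋) ∈ gridIndices d b m := by
  have hb' : (0 : ℝ) < (b : ℝ) ^ m := by positivity
  refine mem_gridIndices.2 fun i => ⟨Int.floor_nonneg.2 ?_, Int.floor_lt.2 ?_⟩
  · exact mul_nonneg hb'.le (hx i).1.le
  · push_cast
    exact mul_lt_of_lt_one_right hb' (hx i).2

theorem measurableSet_gridCell {d : ℕ} (b m : ℕ) (z : Fin d → ℤ) :
    MeasurableSet (gridCell b m z) := by
  have : gridCell b m z = ⋂ i, (fun x : Euc d => ⌊(b : ℝ) ^ m * x i⌋) ⁻¹' {z i} := by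
    ext x; simp [gridCell]
  rw [this]
  refine MeasurableSet.iInter fun i => ?_
  exact (Int.measurable_floor.comp (by fun_prop)) (measurableSet_singleton _)

theorem mem_gridCell_iff_Ico {d b m : ℕ} (hb : 0 < b) {z : Fin d → ℤ} {x : Euc d} :
    x ∈ gridCell b m z ↔
      ∀ i, x i ∈ Set.Ico (z i / (b : ℝ) ^ m) ((z i + 1) / (b : ℝ) ^ m) := by
  have hb' : (0 : ℝ) < (b : ℝ) ^ m := by positivity
  simp only [gridCell, Set.mem_ofPred_eq, Int.floor_eq_iff, Set.mem_Ico, div_le_iff₀ hb',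
    lt_div_iff₀ hb', mul_comm]

theorem convex_gridCell {d b : ℕ} (hb : 0 < b) (m : ℕ) (z : Fin d → ℤ) :
    Convex ℝ (gridCell b m z) := by
  intro x hx y hy α β hα hβ hαβ
  rw [mem_gridCell_iff_Ico hb] at *
  intro i
  exact convex_Ico _ _ (hx i) (hy i) hα hβ hαβ

theorem volume_gridCell {d b : ℕ} (hb : 0 < b) (m : ℕ) (z : Fin d → ℤ) :
    volume (gridCell b m z) = ENNReal.ofReal (((b : ℝ) ^ m)⁻¹ ^ d) := by
  have h : gridCell b m z = (MeasurableEquiv.toLp 2 (Fin d → ℝ)).symm ⁻¹'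
      (Set.univ.pi fun i => Set.Ico (z i / (b : ℝ) ^ m) ((z i + 1) / (b : ℝ) ^ m)) := by
    ext x
    rw [mem_gridCell_iff_Ico hb]
    simp [Set.mem_pi]
  rw [h, (EuclideanSpace.volume_preserving_symm_measurableEquiv_toLp (Fin d)).measure_preimage
    (MeasurableSet.univ_pi fun i => measurableSet_Ico).nullMeasurableSet, Real.volume_pi_Ico]
  have : ∀ i, ((z i + 1) / (b : ℝ) ^ m - z i / (b : ℝ) ^ m) = ((b : ℝ) ^ m)⁻¹ := fun i => by ring
  simp only [this, Finset.prod_const, Finset.card_univ, Fintype.card_fin]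
  rw [ENNReal.ofReal_pow (by positivity)]

theorem dist_le_card_mul {d : ℕ} {x y : Euc d} {ε : ℝ} (hε : 0 ≤ ε)
    (h : ∀ i, |x i - y i| ≤ ε) : dist x y ≤ d * ε := by
  rw [EuclideanSpace.dist_eq]
  refine Real.sqrt_le_iff.2 ⟨by positivity, ?_⟩
  calc ∑ i, dist (x i) (y i) ^ 2 ≤ ∑ _i : Fin d, ε ^ 2 :=
        Finset.sum_le_sum fun i _ => pow_le_pow_left₀ dist_nonneg (by rw [Real.dist_eq]; exact h i) 2
    _ = d * ε ^ 2 := by simp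
    _ ≤ (d * ε) ^ 2 := by
        rw [mul_pow]
        refine mul_le_mul_of_nonneg_right ?_ (sq_nonneg _)
        exact_mod_cast Nat.le_self_pow two_ne_zero d

theorem dist_le_of_mem_gridCell {d b m : ℕ} (hb : 0 < b) {z : Fin d → ℤ} {x y : Euc d}
    (hx : x ∈ gridCell b m z) (hy : y ∈ gridCell b m z) : dist x y ≤ d * ((b : ℝ) ^ m)⁻¹ := by
  rw [mem_gridCell_iff_Ico hb] at hx hy
  refine dist_le_card_mul (by positivity) fun i => ?_
  have h1 := hx i
  have h2 := hy i
  rw [add_div, one_div] at h1 h2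
  rw [abs_le]
  constructor <;> linarith [h1.1, h1.2, h2.1, h2.2]

theorem gridCell_succ_subset {d b m : ℕ} (hb : 0 < b) (z : Fin d → ℤ) :
    gridCell b (m + 1) z ⊆ gridCell b m fun i => z i / (b : ℤ) := by
  intro x hx i
  have hb' : (b : ℝ) ≠ 0 := by positivity
  simp only
  rw [← hx i, ← Int.floor_div_natCast]
  congr 1
  rw [pow_succ]
  field_simp

/-- A grid cell has a child that does not meet `Γ`. -/
theorem exists_child_disjoint {d b m : ℕ} [NeZero d] (hb : 16 * d < b) {Γ : Set (Euc d)}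
    (hc : IsClosed Γ) (hne : Γ.Nonempty) (hint : interior Γ = ∅)
    (hreach : ENNReal.ofReal (((b : ℝ) ^ m)⁻¹ / 4) < reach Γ) (z : Fin d → ℤ) :
    ∃ w : Fin d → ℤ, (∀ i, w i / (b : ℤ) = z i) ∧ ¬(gridCell b (m + 1) w ∩ Γ).Nonempty := by
  have hb0 : 0 < b := by omega
  have hbm : (0 : ℝ) < (b : ℝ) ^ m := by positivity
  -- Porosity at a quarter of the side, around the center: the radius is then half the side, so `x`
  -- stays in the cell, and `x` is at least `1/16` of the side away from `Γ`. Since `16 * d < b`, a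
  -- child has smaller diameter than that.
  obtain ⟨x, hx, hxΓ⟩ := exists_dist_lt_infDist_ge_of_lt_reach hc hne hint
    (by positivity : 0 < ((b : ℝ) ^ m)⁻¹ / 4) hreach
    (WithLp.toLp 2 fun i => (z i + 1 / 2) / (b : ℝ) ^ m)
  have hxz : x ∈ gridCell b m z := by
    rw [mem_gridCell_iff_Ico hb0]
    intro i
    have h2 := (PiLp.norm_apply_le (x - (WithLp.toLp 2 fun i => (z i + 1 / 2) / (b : ℝ) ^ m)) i)
    rw [← dist_eq_norm] at h2
    have h3 := h2.trans_lt hx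
    simp only [PiLp.sub_apply, Real.norm_eq_abs, abs_lt] at h3
    rw [add_div] at h3 ⊢
    rw [div_eq_mul_inv (1 / 2 : ℝ)] at h3
    rw [one_div]
    constructor <;> linarith [h3.1, h3.2]
  refine ⟨fun i => ⌊(b : ℝ) ^ (m + 1) * x i⌋, fun i => ?_, ?_⟩
  · have hmem : x ∈ gridCell b (m + 1) fun i => ⌊(b : ℝ) ^ (m + 1) * x i⌋ := fun i => rfl
    rw [← hxz i]
    exact (gridCell_succ_subset hb0 _ hmem i).symm
  · rintro ⟨y, hy, hyΓ⟩
    have h1 := dist_le_of_mem_gridCell hb0 (fun i => rfl : x ∈ _) hy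
    have h2 := Metric.infDist_le_dist_of_mem (x := x) hyΓ
    have h3 : (d : ℝ) * ((b : ℝ) ^ (m + 1))⁻¹ < ((b : ℝ) ^ m)⁻¹ / 4 / 4 := by
      have hb' : (16 * d : ℝ) < b := by exact_mod_cast hb
      have hb'' : (0 : ℝ) < b := by positivity
      rw [pow_succ, mul_inv]
      have : (d : ℝ) * (b : ℝ)⁻¹ < 1 / 16 := by
        rw [← div_eq_mul_inv, div_lt_iff₀ hb'']; linarith
      have := mul_lt_mul_of_pos_right this (inv_pos.2 hbm)
      linarith
    linarith

/-- Parents of cells that meet `Γ` meet `Γ` too, and at least one of the `b ^ d` children of each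
parent is lost. -/
theorem card_gridMeeting_succ_le {d b m : ℕ} [NeZero d] (hb : 16 * d < b) {Γ : Set (Euc d)}
    (hc : IsClosed Γ) (hne : Γ.Nonempty) (hint : interior Γ = ∅)
    (hreach : ENNReal.ofReal (((b : ℝ) ^ m)⁻¹ / 4) < reach Γ) :
    (gridMeeting b (m + 1) Γ).card ≤ (b ^ d - 1) * (gridMeeting b m Γ).card := by
  classical
  have hb0 : 0 < b := by omega
  refine Finset.card_le_mul_card_image_of_maps_to (f := fun w i => w i / (b : ℤ)) ?_ _ ?_
  · intro w hw
    simp only [gridMeeting, Finset.mem_filter, mem_gridIndices] at hw ⊢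
    obtain ⟨hw, y, hy, hyΓ⟩ := hw
    refine ⟨fun i => ⟨Int.ediv_nonneg (hw i).1 (by omega), ?_⟩, y, gridCell_succ_subset hb0 _ hy, hyΓ⟩
    refine Int.ediv_lt_of_lt_mul (by omega) ?_
    rw [← pow_succ]
    exact (hw i).2
  · intro z _
    obtain ⟨w, hwz, hwΓ⟩ := exists_child_disjoint hb hc hne hint hreach z
    let C : Finset (Fin d → ℤ) :=
      Fintype.piFinset fun i => Finset.Ico (b * z i) (b * z i + b)
    have hC : ∀ w : Fin d → ℤ, w ∈ C ↔ ∀ i, w i / (b : ℤ) = z i := fun w => by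
      simp only [C, Fintype.mem_piFinset, Finset.mem_Ico]
      refine forall_congr' fun i => ?_
      rw [Int.ediv_eq_iff_of_pos (by omega)]
      constructor <;> intro h <;> constructor <;> nlinarith [h.1, h.2]
    have hCcard : C.card = b ^ d := by simp [C, Fintype.card_piFinset]
    calc _ ≤ (C.erase w).card := by
          refine Finset.card_le_card fun v hv => ?_
          simp only [gridMeeting, Finset.mem_filter] at hv
          refine Finset.mem_erase.2 ⟨?_, (hC v).2 fun i => congrFun hv.2 i⟩
          rintro rfl
          exact hwΓ hv.1.2
      _ = b ^ d - 1 := by rw [Finset.card_erase_of_mem ((hC w).2 hwz), hCcard]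

/-- The number of grid cells meeting a set of positive reach without interior decays geometrically,
relative to the number of all grid cells. -/
theorem card_gridMeeting_le {d b m₀ : ℕ} [NeZero d] (hb : 16 * d < b) {Γ : Set (Euc d)}
    (hc : IsClosed Γ) (hint : interior Γ = ∅)
    (hreach : ENNReal.ofReal (((b : ℝ) ^ m₀)⁻¹ / 4) < reach Γ) (j : ℕ) :
    ((gridMeeting b (m₀ + j) Γ).card : ℝ) ≤
      (1 - ((b : ℝ) ^ d)⁻¹) ^ j * ((b : ℝ) ^ (m₀ + j)) ^ d := by
  classical
  have hb0 : 0 < b := by omega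
  have hbd : 1 ≤ b ^ d := Nat.one_le_pow _ _ hb0
  have hbd' : (0 : ℝ) < (b : ℝ) ^ d := by positivity
  induction j with
  | zero =>
    have : (gridMeeting b m₀ Γ).card ≤ (b ^ m₀) ^ d := by
      rw [← card_gridIndices]; exact Finset.card_filter_le _ _
    simpa using (show ((gridMeeting b m₀ Γ).card : ℝ) ≤ _ by exact_mod_cast this)
  | succ j ih =>
    rcases Γ.eq_empty_or_nonempty with rfl | hne
    · have hq : (0 : ℝ) ≤ 1 - ((b : ℝ) ^ d)⁻¹ := by
        rw [sub_nonneg]; exact inv_le_one_of_one_le₀ (by exact_mod_cast hbd)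
      simp only [gridMeeting, Set.inter_empty, Set.not_nonempty_empty, Finset.filter_false,
        Finset.card_empty, Nat.cast_zero]
      positivity
    have hle : ENNReal.ofReal (((b : ℝ) ^ (m₀ + j))⁻¹ / 4) < reach Γ := by
      refine lt_of_le_of_lt (ENNReal.ofReal_le_ofReal ?_) hreach
      gcongr
      · exact_mod_cast hb0
      · omega
    have h := card_gridMeeting_succ_le hb hc hne hint hle
    have h' : ((gridMeeting b (m₀ + j + 1) Γ).card : ℝ) ≤
        ((b : ℝ) ^ d - 1) * (gridMeeting b (m₀ + j) Γ).card := by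
      have : ((b ^ d - 1 : ℕ) : ℝ) = (b : ℝ) ^ d - 1 := by push_cast [hbd]; rfl
      rw [← this]; exact_mod_cast h
    have h1 : (0 : ℝ) ≤ (b : ℝ) ^ d - 1 := by
      rw [sub_nonneg]; exact_mod_cast hbd
    rw [← add_assoc]
    refine h'.trans ((mul_le_mul_of_nonneg_left ih h1).trans_eq ?_)
    rw [pow_succ (1 - ((b : ℝ) ^ d)⁻¹), pow_succ (b : ℝ), mul_pow]
    field_simp

/-! ### Concentration of the empirical measure -/

/-- The empirical measure `(1/n) ∑_i δ_{x_i}`. -/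
noncomputable def empiricalMeasure {E : Type*} [MeasurableSpace E] {n : ℕ} (x : Fin n → E) :
    Measure E :=
  (n : ℝ≥0∞)⁻¹ • ∑ i, Measure.dirac (x i)

theorem isProbabilityMeasure_empiricalMeasure {E : Type*} [MeasurableSpace E] {n : ℕ}
    (hn : n ≠ 0) (x : Fin n → E) : IsProbabilityMeasure (empiricalMeasure x) := by
  constructor
  simp [empiricalMeasure]
  exact ENNReal.inv_mul_cancel (by simpa using hn) (by simp)

theorem integral_empiricalMeasure {E : Type*} [MeasurableSpace E] {n : ℕ} (x : Fin n → E)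
    {F : E → ℝ} (hF : Measurable F) :
    ∫ y, F y ∂(empiricalMeasure x) = (n : ℝ)⁻¹ * ∑ i, F (x i) := by
  rw [empiricalMeasure, integral_smul_measure, integral_finsetSum_measure]
  · simp [integral_dirac' _ _ hF.stronglyMeasurable]
  · intro i _
    exact (integrable_dirac' hF.stronglyMeasurable (by simp))

theorem empiricalMeasure_real_apply {E : Type*} [MeasurableSpace E] {n : ℕ} (x : Fin n → E)
    {C : Set E} (hC : MeasurableSet C) :
    (empiricalMeasure x).real C = (n : ℝ)⁻¹ * ∑ i, C.indicator (fun _ => (1 : ℝ)) (x i) := by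
  rw [← integral_empiricalMeasure x (measurable_const.indicator hC), integral_indicator hC]
  simp

/-- Hoeffding's inequality for the empirical measure of a set. -/
theorem measure_le_abs_empiricalMeasure_sub_le {E Ω : Type*} [MeasurableSpace E]
    [MeasurableSpace Ω] {P : Measure Ω} [IsProbabilityMeasure P] {μ : Measure E}
    {X : ℕ → Ω → E} (hX_meas : ∀ i, Measurable (X i)) (hX_indep : iIndepFun X P)
    (hX_law : ∀ i, P.map (X i) = μ) {C : Set E} (hC : MeasurableSet C) {n : ℕ} (hn : n ≠ 0)
    {t : ℝ} (ht : 0 ≤ t) :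
    P {ω | t ≤ |(empiricalMeasure fun i : Fin n => X i ω).real C - μ.real C|} ≤
      ENNReal.ofReal (2 * Real.exp (-(2 * n * t ^ 2))) := by
  have hn' : (0 : ℝ) < n := by positivity
  let I : E → ℝ := C.indicator fun _ => (1 : ℝ)
  have hI : Measurable I := measurable_const.indicator hC
  have hI01 : ∀ x, I x ∈ Set.Icc (0 : ℝ) 1 := fun x => by
    by_cases hx : x ∈ C <;> simp [I, hx]
  have hmean : ∀ i, ∫ ω, I (X i ω) ∂P = μ.real C := fun i => by
    rw [← hX_law i, map_measureReal_apply (hX_meas i) hC]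
    have : (fun ω => I (X i ω)) = (X i ⁻¹' C).indicator fun _ => (1 : ℝ) := rfl
    rw [this, integral_indicator (hX_meas i hC)]
    simp
  have hsub : ∀ i, HasSubgaussianMGF (fun ω => I (X i ω) - μ.real C) ((1 / 2 : ℝ≥0) ^ 2) P :=
    fun i => by
      have := hasSubgaussianMGF_of_mem_Icc (μ := P) (X := fun ω => I (X i ω))
        (hI.comp (hX_meas i)).aemeasurable (Eventually.of_forall fun ω => hI01 (X i ω))
      simpa [hmean i] using this
  have hind : iIndepFun (fun i ω => I (X i ω) - μ.real C) P :=
    hX_indep.comp (fun _ x => I x - μ.real C) fun _ => hI.sub_const _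
  have hind' : iIndepFun (fun i ω => -(I (X i ω) - μ.real C)) P :=
    hX_indep.comp (fun _ x => -(I x - μ.real C)) fun _ => (hI.sub_const _).neg
  have h1 := HasSubgaussianMGF.measure_sum_range_ge_le_of_iIndepFun hind (n := n)
    (fun i _ => hsub i) (ε := n * t) (by positivity)
  have h2 := HasSubgaussianMGF.measure_sum_range_ge_le_of_iIndepFun hind' (n := n)
    (fun i _ => (hsub i).neg) (ε := n * t) (by positivity)
  have hexp : -(n * t) ^ 2 / (2 * n * (((1 / 2 : ℝ≥0) ^ 2 : ℝ≥0) : ℝ)) = -(2 * n * t ^ 2) := by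
    push_cast
    field_simp
  rw [hexp] at h1 h2
  rw [← ofReal_measureReal]
  refine ENNReal.ofReal_le_ofReal ?_
  rw [two_mul]
  refine (measureReal_mono ?_).trans ((measureReal_union_le _ _).trans (add_le_add h1 h2))
  intro ω hω
  simp only [Set.mem_ofPred_eq, empiricalMeasure_real_apply _ hC] at hω
  have hsum : ∑ i ∈ Finset.range n, (I (X i ω) - μ.real C) =
      n * ((n : ℝ)⁻¹ * ∑ i : Fin n, I (X i ω) - μ.real C) := by
    rw [Finset.sum_sub_distrib, Fin.sum_univ_eq_sum_range (fun i => I (X i ω)) n]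
    simp only [Finset.sum_const, Finset.card_range, nsmul_eq_mul]
    field_simp
  rcases le_abs.1 hω with h | h
  · left
    simp only [Set.mem_ofPred_eq]
    rw [hsum]
    exact mul_le_mul_of_nonneg_left h hn'.le
  · right
    simp only [Set.mem_ofPred_eq]
    rw [Finset.sum_neg_distrib, hsum, ← mul_neg]
    exact mul_le_mul_of_nonneg_left h hn'.le

/-- Uniform concentration of the empirical measures over growing finite families of sets. -/
theorem ae_eventually_forall_abs_empiricalMeasure_sub_lt {E Ω ι : Type*} [MeasurableSpace E]
    [MeasurableSpace Ω] {P : Measure Ω} [IsProbabilityMeasure P] {μ : Measure E}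
    {X : ℕ → Ω → E} (hX_meas : ∀ i, Measurable (X i)) (hX_indep : iIndepFun X P)
    (hX_law : ∀ i, P.map (X i) = μ) {s : ℕ → Finset ι} {C : ℕ → ι → Set E}
    (hC : ∀ n z, MeasurableSet (C n z)) {t : ℕ → ℝ} (ht : ∀ n, 0 ≤ t n)
    (hsum : Summable fun n : ℕ => (s n).card * (2 * Real.exp (-(2 * n * t n ^ 2)))) :
    ∀ᵐ ω ∂P, ∀ᶠ n : ℕ in atTop, ∀ z ∈ s n,
      |(empiricalMeasure fun i : Fin n => X i ω).real (C n z) - μ.real (C n z)| < t n := by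
  have hbound : ∀ n : ℕ, n ≠ 0 → P (⋃ z ∈ s n,
      {ω | t n ≤ |(empiricalMeasure fun i : Fin n => X i ω).real (C n z) - μ.real (C n z)|}) ≤
      ENNReal.ofReal ((s n).card * (2 * Real.exp (-(2 * n * t n ^ 2)))) := fun n hn => by
    refine (measure_biUnion_finset_le _ _).trans ?_
    refine (Finset.sum_le_sum fun z _ => measure_le_abs_empiricalMeasure_sub_le hX_meas hX_indep
      hX_law (hC n z) hn (ht n)).trans ?_
    rw [Finset.sum_const, nsmul_eq_mul, ENNReal.ofReal_mul (p := ((s n).card : ℝ)) (by positivity),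
      ENNReal.ofReal_natCast]
  -- The index is shifted because the bound needs a nonempty sample.
  have hfin : ∑' n, P (⋃ z ∈ s (n + 1), {ω | t (n + 1) ≤
      |(empiricalMeasure fun i : Fin (n + 1) => X i ω).real (C (n + 1) z) -
        μ.real (C (n + 1) z)|}) ≠ ∞ := by
    refine ne_top_of_le_ne_top ?_ (ENNReal.tsum_le_tsum fun n => hbound (n + 1) n.succ_ne_zero)
    exact ((summable_nat_add_iff 1).2 hsum).tsum_ofReal_ne_top
  filter_upwards [ae_eventually_notMem hfin] with ω hω
  obtain ⟨N, hN⟩ := eventually_atTop.1 hω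
  refine eventually_atTop.2 ⟨N + 1, fun n hn z hz => ?_⟩
  obtain ⟨k, rfl⟩ : ∃ k, n = k + 1 := ⟨n - 1, by omega⟩
  have hn := hN k (by omega)
  simp only [Set.mem_iUnion, not_exists, Set.mem_ofPred_eq, not_le] at hn
  exact hn z hz

/-! ### From cells to integrals -/

/-- The integrals of a function with respect to two probability measures are close if the
measures are close on each cell of a partition, and the function is almost constant on all cells
but few. -/
theorem abs_integral_sub_integral_le {E ι : Type*} [MeasurableSpace E] {μ ν : Measure E}
    [IsProbabilityMeasure μ] [IsProbabilityMeasure ν] {s T : Finset ι} {C : ι → Set E}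
    (hC : ∀ z, MeasurableSet (C z)) (hdisj : Pairwise (Function.onFun Disjoint C))
    (hμ : ∀ᵐ x ∂μ, x ∈ ⋃ z ∈ s, C z) (hν : ∀ᵐ x ∂ν, x ∈ ⋃ z ∈ s, C z) {F : E → ℝ}
    (hF : Measurable F) {B : ℝ} (hB : 0 ≤ B) (hFB : ∀ x, |F x| ≤ B) (hTs : T ⊆ s) {η : ℝ} (hη : 0 ≤ η)
    (hosc : ∀ z ∈ s, z ∉ T → ∃ a, |a| ≤ B ∧ ∀ x ∈ C z, |F x - a| ≤ η) {t : ℝ}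
    (ht : ∀ z ∈ s, |ν.real (C z) - μ.real (C z)| ≤ t) {p : ℝ} (hT : ∀ z ∈ T, μ.real (C z) ≤ p) :
    |∫ x, F x ∂ν - ∫ x, F x ∂μ| ≤ 2 * B * (s.card * t) + 2 * B * (T.card * p) + 2 * η := by
  classical
  have hint : ∀ (κ : Measure E) [IsProbabilityMeasure κ], Integrable F κ := fun κ _ =>
    Integrable.of_bound hF.aestronglyMeasurable B (Eventually.of_forall fun x => by
      simpa using hFB x)
  have hsplit : ∀ (κ : Measure E) [IsProbabilityMeasure κ], (∀ᵐ x ∂κ, x ∈ ⋃ z ∈ s, C z) →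
      ∫ x, F x ∂κ = ∑ z ∈ s, ∫ x in C z, F x ∂κ := fun κ _ hκ => by
    rw [← integral_biUnion_finset s (fun z _ => hC z) (fun z _ w _ h => hdisj h)
      (fun z _ => (hint κ).integrableOn), Measure.restrict_eq_self_of_ae_mem hκ]
  have hmass : ∀ (κ : Measure E) [IsProbabilityMeasure κ], ∑ z ∈ s, κ.real (C z) ≤ 1 :=
    fun κ _ => by
      rw [← measureReal_biUnion_finset (fun z _ w _ h => hdisj h) (fun z _ => hC z)]
      exact measureReal_le_one
  have hconst : ∀ (κ : Measure E) [IsProbabilityMeasure κ] (z : ι) (a b : ℝ),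
      (∀ x ∈ C z, |F x - a| ≤ b) → |∫ x in C z, F x ∂κ - a * κ.real (C z)| ≤ b * κ.real (C z) :=
    fun κ _ z a b h => by
      have : ∫ x in C z, F x ∂κ - a * κ.real (C z) = ∫ x in C z, (F x - a) ∂κ := by
        rw [integral_sub (hint κ).integrableOn (integrable_const _)]
        simp [mul_comm]
      rw [this]
      exact norm_setIntegral_le_of_norm_le_const (measure_lt_top κ (C z))
        (f := fun x => F x - a) (by simpa using h)
  have hcell : ∀ z ∈ s, |∫ x in C z, F x ∂ν - ∫ x in C z, F x ∂μ| ≤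
      2 * B * t + (if z ∈ T then 2 * B * p else 0) + η * ν.real (C z) + η * μ.real (C z) := by
    intro z hz
    have hνz := measureReal_nonneg (μ := ν) (s := C z)
    have hμz := measureReal_nonneg (μ := μ) (s := C z)
    have htz := ht z hz
    by_cases hzT : z ∈ T
    · have h1 := hconst ν z 0 B fun x _ => by simpa using hFB x
      have h2 := hconst μ z 0 B fun x _ => by simpa using hFB x
      simp only [zero_mul, sub_zero] at h1 h2
      have h3 := (abs_sub _ _).trans (add_le_add h1 h2)
      -- On an exceptional cell only `|F| ≤ B` is available, and the `ν`-mass is controlled through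
      -- the `μ`-mass.
      have h4 : ν.real (C z) ≤ t + μ.real (C z) := by linarith [(abs_le.1 htz).2]
      have h5 := mul_le_mul_of_nonneg_left h4 hB
      have h6 := mul_le_mul_of_nonneg_left (hT z hzT) hB
      have h7 : 0 ≤ B * t := mul_nonneg hB ((abs_nonneg _).trans htz)
      rw [if_pos hzT]
      nlinarith [mul_nonneg hη hνz, mul_nonneg hη hμz]
    · obtain ⟨a, ha, haF⟩ := hosc z hz hzT
      have h1 := hconst ν z a η haF
      have h2 := hconst μ z a η haF
      have h3 : |a * (ν.real (C z) - μ.real (C z))| ≤ B * t := by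
        rw [abs_mul]
        exact mul_le_mul ha htz (abs_nonneg _) hB
      have h7 : 0 ≤ B * t := mul_nonneg hB ((abs_nonneg _).trans htz)
      rw [if_neg hzT]
      rw [abs_le] at h1 h2 h3 ⊢
      constructor <;> linarith [h1.1, h1.2, h2.1, h2.2, h3.1, h3.2]
  rw [hsplit ν hν, hsplit μ hμ, ← Finset.sum_sub_distrib]
  refine (Finset.abs_sum_le_sum_abs _ _).trans ((Finset.sum_le_sum hcell).trans ?_)
  rw [Finset.sum_add_distrib, Finset.sum_add_distrib, Finset.sum_add_distrib, ← Finset.mul_sum,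
    ← Finset.mul_sum, ← Finset.mul_sum, Finset.sum_ite_mem, Finset.inter_eq_right.2 hTs]
  simp only [Finset.sum_const, nsmul_eq_mul]
  have h1 := mul_le_mul_of_nonneg_left (hmass ν) hη
  have h2 := mul_le_mul_of_nonneg_left (hmass μ) hη
  linarith

theorem pairwise_disjoint_gridCell {d : ℕ} (b m : ℕ) :
    Pairwise (Function.onFun Disjoint (gridCell (d := d) b m)) := by
  intro z w hzw
  refine Set.disjoint_left.2 fun x hz hw => hzw ?_
  ext i
  rw [← hz i, hw i]

theorem mem_iUnion_gridCell {d b : ℕ} (hb : 0 < b) (m : ℕ) {x : Euc d} (hx : x ∈ openCube d) :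
    x ∈ ⋃ z ∈ gridIndices d b m, gridCell b m z :=
  Set.mem_biUnion (floor_mem_gridIndices hb hx) fun _ => rfl

theorem gridCell_subset_closedBall {d b m : ℕ} (hb : 0 < b) {z : Fin d → ℤ}
    (hz : z ∈ gridIndices d b m) : gridCell b m z ⊆ Metric.closedBall (0 : Euc d) d := by
  intro x hx
  have hbm : (0 : ℝ) < (b : ℝ) ^ m := by positivity
  rw [mem_gridCell_iff_Ico hb] at hx
  have := dist_le_card_mul (x := x) (y := 0) zero_le_one fun i => by
    have h1 := mem_gridIndices.1 hz i
    have h2 : (0 : ℝ) ≤ z i := by exact_mod_cast h1.1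
    have h3 : (z i : ℝ) + 1 ≤ (b : ℝ) ^ m := by exact_mod_cast h1.2
    have h4 : (0 : ℝ) ≤ x i := le_trans (by positivity) (hx i).1
    have h5 : x i ≤ 1 := (hx i).2.le.trans ((div_le_one hbm).2 h3)
    simpa [abs_of_nonneg h4] using h5
  simpa using this

/-- A cell is convex, hence connected, so it cannot meet both the interior and the exterior of `R`
without meeting the frontier. -/
theorem gridCell_subset_or_disjoint {d b m : ℕ} (hb : 0 < b) {z : Fin d → ℤ} {R : Set (Euc d)}
    (h : ¬(gridCell b m z ∩ frontier R).Nonempty) :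
    gridCell b m z ⊆ R ∨ Disjoint (gridCell b m z) R := by
  by_contra! hcon
  obtain ⟨y, hy, hyR⟩ := Set.not_disjoint_iff.1 hcon.2
  obtain ⟨x, hx, hxR⟩ := Set.not_subset.1 hcon.1
  have hcases : ∀ w ∈ gridCell b m z, w ∈ interior R ∨ w ∈ (closure R)ᶜ := fun w hw => by
    by_contra! hcon'
    exact h ⟨w, hw, not_not.1 hcon'.2, hcon'.1⟩
  obtain ⟨w, -, hw, hw'⟩ := (convex_gridCell hb m z).isPreconnected _ _ isOpen_interior
    isClosed_closure.isOpen_compl hcases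
    ⟨y, hy, (hcases y hy).resolve_right fun h => h (subset_closure hyR)⟩
    ⟨x, hx, (hcases x hx).resolve_left fun h => hxR (interior_subset h)⟩
  exact hw' (subset_closure (interior_subset hw))

/-- If the measures `ν n` approximate `μ` well on grid cells, and the proportion of grid cells
meeting the boundary of `R n` tends to zero, then the integrals over `R n` of a bounded continuous
function with respect to `ν n` and to `μ` approach each other. -/
theorem tendsto_integral_indicator_sub {d b : ℕ} (hb : 1 < b) {μ : Measure (Euc d)}
    [IsProbabilityMeasure μ] {ν : ℕ → Measure (Euc d)}
    (hν : ∀ᶠ n in atTop, IsProbabilityMeasure (ν n)) (hμcube : ∀ᵐ x ∂μ, x ∈ openCube d)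
    (hνcube : ∀ n, ∀ᵐ x ∂(ν n), x ∈ openCube d) {m : ℕ → ℕ} (hm : Tendsto m atTop atTop) {c : ℝ}
    (hc : ∀ m z, μ.real (gridCell b m z) ≤ c * (((b : ℝ) ^ m) ^ d)⁻¹) {t : ℕ → ℝ}
    (ht : ∀ᶠ n in atTop, ∀ z ∈ gridIndices d b (m n),
      |(ν n).real (gridCell b (m n) z) - μ.real (gridCell b (m n) z)| < t n)
    (htlim : Tendsto (fun n => ((b : ℝ) ^ m n) ^ d * t n) atTop (𝓝 0)) {R : ℕ → Set (Euc d)}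
    (hR : ∀ n, IsOpen (R n))
    (hRlim : Tendsto (fun n => ((gridMeeting b (m n) (frontier (R n))).card : ℝ) *
      (((b : ℝ) ^ m n) ^ d)⁻¹) atTop (𝓝 0)) (f : BoundedContinuousFunction (Euc d) ℝ) :
    Tendsto (fun n => ∫ x, (R n).indicator f x ∂(ν n) - ∫ x, (R n).indicator f x ∂μ) atTop
      (𝓝 0) := by
  classical
  have hb0 : 0 < b := by omega
  rw [Metric.tendsto_nhds]
  intro ε hε
  obtain ⟨δ, hδ, hδf⟩ := Metric.uniformContinuousOn_iff.1
    ((isCompact_closedBall (0 : Euc d) d).uniformContinuousOn_of_continuous f.continuous.continuousOn)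
    (ε / 8) (by positivity)
  have hdiam : ∀ᶠ n in atTop, (d : ℝ) * ((b : ℝ) ^ m n)⁻¹ < δ := by
    have h1 : Tendsto (fun n => ((b : ℝ) ^ m n)⁻¹) atTop (𝓝 0) :=
      ((tendsto_pow_atTop_atTop_of_one_lt (by exact_mod_cast hb)).comp hm).inv_tendsto_atTop
    have h2 := h1.const_mul (d : ℝ)
    rw [mul_zero] at h2
    exact h2.eventually_lt_const hδ
  have herr : ∀ᶠ n in atTop, 2 * ‖f‖ * (((b : ℝ) ^ m n) ^ d * t n) + 2 * ‖f‖ * c *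
      (((gridMeeting b (m n) (frontier (R n))).card : ℝ) * (((b : ℝ) ^ m n) ^ d)⁻¹) < ε / 2 := by
    have h := (htlim.const_mul (2 * ‖f‖)).add (hRlim.const_mul (2 * ‖f‖ * c))
    rw [mul_zero, mul_zero, add_zero] at h
    exact h.eventually_lt_const (by positivity)
  filter_upwards [hν, ht, hdiam, herr] with n hνn htn hdn hen
  rw [dist_zero_right, Real.norm_eq_abs]
  have hbound : ∀ x, |(R n).indicator f x| ≤ ‖f‖ := fun x => by
    by_cases hx : x ∈ R n
    · simpa [hx] using f.norm_coe_le_norm x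
    · simp [hx]
  have h := abs_integral_sub_integral_le (μ := μ) (ν := ν n) (s := gridIndices d b (m n))
    (T := gridMeeting b (m n) (frontier (R n))) (C := gridCell b (m n))
    (measurableSet_gridCell b (m n)) (pairwise_disjoint_gridCell b (m n))
    (hμcube.mono fun x hx => mem_iUnion_gridCell hb0 _ hx)
    ((hνcube n).mono fun x hx => mem_iUnion_gridCell hb0 _ hx)
    (f.continuous.measurable.indicator (hR n).measurableSet) (norm_nonneg f) hbound
    (Finset.filter_subset _ _) (by positivity : 0 ≤ ε / 8) (fun z hz hzT => ?_)
    (fun z hz => (htn z hz).le) (fun z _ => hc (m n) z)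
  · rw [card_gridIndices] at h
    push_cast at h
    linarith
  · have hzf : ¬(gridCell b (m n) z ∩ frontier (R n)).Nonempty := fun h =>
      hzT (Finset.mem_filter.2 ⟨hz, h⟩)
    rcases gridCell_subset_or_disjoint hb0 hzf with hsub | hdis
    · rcases (gridCell b (m n) z).eq_empty_or_nonempty with he | ⟨y, hy⟩
      · exact ⟨0, by simp, by simp [he]⟩
      · refine ⟨f y, f.norm_coe_le_norm y, fun x hx => ?_⟩
        rw [Set.indicator_of_mem (hsub hx)]
        exact (hδf x (gridCell_subset_closedBall hb0 hz hx) y (gridCell_subset_closedBall hb0 hz hy)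
          ((dist_le_of_mem_gridCell hb0 hx hy).trans_lt hdn)).le
    · refine ⟨0, by simp, fun x hx => ?_⟩
      rw [Set.indicator_of_notMem (Set.disjoint_left.1 hdis hx)]
      simp; positivity

/-! ### Choice of the grid scale -/

/-- With `K n ^ 8 ≤ n`, the quantity `n / K n ^ 4` is at least `√n`; this beats the factor `K n ≤ n`
once the exponential is bounded by the sixth term of its series. -/
theorem summable_mul_exp_of_pow_le {K : ℕ → ℕ} (hK : ∀ n, 0 < K n)
    (hKn : ∀ n, n ≠ 0 → K n ^ 8 ≤ n) :
    Summable fun n : ℕ => (K n : ℝ) * (2 * Real.exp (-(2 * n * (((K n : ℝ) ^ 2)⁻¹) ^ 2))) := by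
  refine Summable.of_norm_bounded_eventually_nat
    ((Real.summable_nat_pow_inv.2 one_lt_two).mul_left 24) ?_
  filter_upwards [eventually_ne_atTop 0] with n hn
  have hn0 : (0 : ℝ) < n := by positivity
  have hk : (0 : ℝ) < K n := by exact_mod_cast hK n
  have hkn : (K n : ℝ) ^ 8 ≤ n := by exact_mod_cast hKn n hn
  have hk1 : (1 : ℝ) ≤ K n := by exact_mod_cast hK n
  have hkn' : (K n : ℝ) ≤ n := (le_self_pow₀ hk1 (by norm_num)).trans hkn
  rw [Real.norm_of_nonneg (by positivity)]
  set y : ℝ := n * (((K n : ℝ) ^ 2)⁻¹) ^ 2 with hy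
  have hy0 : 0 < y := by positivity
  have hy2 : (n : ℝ) ≤ y ^ 2 := by
    have : y ^ 2 = n ^ 2 / (K n : ℝ) ^ 8 := by rw [hy]; field_simp
    rw [this, le_div_iff₀ (by positivity), sq]
    gcongr
  have hy6 : (n : ℝ) ^ 3 ≤ y ^ 6 := by
    calc (n : ℝ) ^ 3 ≤ (y ^ 2) ^ 3 := by gcongr
      _ = y ^ 6 := by ring
  have hexp := Real.pow_div_factorial_le_exp (2 * y) (by positivity) 6
  have h1 : (n : ℝ) ^ 3 / 12 ≤ Real.exp (2 * y) := by
    refine le_trans ?_ hexp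
    norm_num [Nat.factorial]
    rw [mul_pow]
    linarith [pow_pos hy0 6]
  rw [mul_assoc 2 (n : ℝ), ← hy, Real.exp_neg]
  calc (K n : ℝ) * (2 * (Real.exp (2 * y))⁻¹) ≤ n * (2 * ((n : ℝ) ^ 3 / 12)⁻¹) := by gcongr
    _ = 24 * ((n : ℝ) ^ 2)⁻¹ := by field_simp; norm_num

theorem tendsto_nat_log_atTop {B : ℕ} (hB : 1 < B) : Tendsto (Nat.log B) atTop atTop := by
  refine tendsto_atTop.2 fun j => ?_
  filter_upwards [eventually_ge_atTop (B ^ j)] with n hn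
  exact Nat.le_log_of_pow_le hB hn

/-- The radii `ρ n` dominate `bʲ` times the side of the cells of a grid with about `n ^ (1/8)`
cells. -/
theorem eventually_inv_pow_log_le {d b : ℕ} [NeZero d] (hb : 1 < b) {r ρ : ℕ → ℝ}
    (hr_pos : ∀ n, 0 < r n) (hρ_pos : ∀ n, 0 < ρ n) (hr_lim : Tendsto r atTop (𝓝 0))
    (hρ_rate : ∀ α : ℝ, 0 < α →
      Tendsto (fun n : ℕ => (n : ℝ) * r n ^ (2 * d + 1) * ρ n ^ α) atTop atTop) (j : ℕ) :
    ∀ᶠ n : ℕ in atTop, ((b : ℝ) ^ (Nat.log (b ^ (8 * d)) n - j))⁻¹ ≤ ρ n := by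
  have hd : 0 < d := Nat.pos_of_ne_zero (NeZero.ne d)
  have hb0 : (0 : ℝ) < b := by positivity
  have hB : 1 < b ^ (8 * d) := Nat.one_lt_pow (by omega) hb
  -- The exponent `α = 8 * d` matches the base `b ^ (8 * d)` of the logarithm, so that a comparison
  -- of `8 * d`-th powers gives `b ^ (j + 1) ≤ b ^ (m + 1) * ρ n`.
  filter_upwards [(hρ_rate (8 * d : ℕ) (by positivity)).eventually_ge_atTop
      (((b : ℝ) ^ (j + 1)) ^ (8 * d)), hr_lim.eventually_le_const one_pos,
    (tendsto_nat_log_atTop hB).eventually_ge_atTop j] with n hn hr1 hj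
  set m := Nat.log (b ^ (8 * d)) n with hm
  rw [Real.rpow_natCast] at hn
  have h1 : (n : ℝ) * r n ^ (2 * d + 1) * ρ n ^ (8 * d) ≤ n * 1 * ρ n ^ (8 * d) := by
    have := hρ_pos n
    have := pow_le_one₀ (n := 2 * d + 1) (hr_pos n).le hr1
    gcongr
  have h2 : (n : ℝ) ≤ ((b : ℝ) ^ (m + 1)) ^ (8 * d) := by
    rw [← pow_mul, mul_comm, pow_mul]
    exact_mod_cast (Nat.lt_pow_succ_log_self hB n).le
  have h3 : ((b : ℝ) ^ (j + 1)) ^ (8 * d) ≤ ((b : ℝ) ^ (m + 1) * ρ n) ^ (8 * d) := by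
    rw [mul_pow]
    refine hn.trans (h1.trans ?_)
    rw [mul_one]
    have := hρ_pos n
    gcongr
  have h4 : (b : ℝ) ^ (j + 1) ≤ (b : ℝ) ^ (m + 1) * ρ n :=
    le_of_pow_le_pow_left₀ (by positivity) (by have := hρ_pos n; positivity) h3
  have h5 : (b : ℝ) ^ (m + 1) = b ^ (m - j) * b ^ (j + 1) := by
    rw [← pow_add]; congr 1; omega
  rw [h5] at h4
  rw [inv_le_iff_one_le_mul₀ (by positivity)]
  have h6 : (0 : ℝ) < (b : ℝ) ^ (j + 1) := by positivity
  nlinarith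

/-! ### Passage to the limit -/

theorem integral_discreteMeasure {d n : ℕ} (x : Fin n → Euc d) {R : Set (Euc d)}
    (hR : MeasurableSet R) (f : BoundedContinuousFunction (Euc d) ℝ) :
    ∫ y, f y ∂(discreteMeasure x R : Measure (Euc d)) =
      ∫ y, R.indicator f y ∂(empiricalMeasure x) := by
  rw [integral_empiricalMeasure x (f.continuous.measurable.indicator hR), discreteMeasure,
    FiniteMeasure.toMeasure_smul, FiniteMeasure.toMeasure_sum, integral_smul_nnreal_measure,
    integral_finsetSum_measure fun i _ => BoundedContinuousFunction.integrable _ f]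
  simp only [NNReal.smul_def, NNReal.coe_inv, NNReal.coe_natCast, smul_eq_mul]
  congr 1
  refine Finset.sum_congr rfl fun i _ => ?_
  rw [FiniteMeasure.toMeasure_smul, integral_smul_nnreal_measure,
    show ((diracMass (x i) : FiniteMeasure (Euc d)) : Measure (Euc d)) = Measure.dirac (x i) from rfl,
    integral_dirac]
  by_cases hx : x i ∈ R <;> simp [hx]

theorem ae_empiricalMeasure_mem {E : Type*} [MeasurableSpace E] {n : ℕ} {x : Fin n → E} {S : Set E}
    (hS : MeasurableSet S) (hx : ∀ i, x i ∈ S) : ∀ᵐ y ∂(empiricalMeasure x), y ∈ S := by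
  rw [ae_iff, show {y | ¬y ∈ S} = Sᶜ from rfl]
  simp [empiricalMeasure, Measure.dirac_apply' _ hS.compl, hx]

theorem tendsto_setIntegral_of_tendsto_symmDiff {E : Type*} [MeasurableSpace E]
    [TopologicalSpace E] [OpensMeasurableSpace E] {μ : Measure E} [IsFiniteMeasure μ]
    {R : ℕ → Set E} (hR : ∀ k, MeasurableSet (R k)) {A : Set E} (hA : MeasurableSet A)
    (h : Tendsto (fun k => μ (symmDiff (R k) A)) atTop (𝓝 0))
    (f : BoundedContinuousFunction E ℝ) :
    Tendsto (fun k => ∫ x, (R k).indicator f x ∂μ) atTop (𝓝 (∫ x in A, f x ∂μ)) := by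
  have hreal : Tendsto (fun k => ‖f‖ * μ.real (symmDiff (R k) A)) atTop (𝓝 0) := by
    have := ((ENNReal.tendsto_toReal ENNReal.zero_ne_top).comp h).const_mul ‖f‖
    rwa [ENNReal.toReal_zero, mul_zero] at this
  rw [tendsto_iff_dist_tendsto_zero]
  refine squeeze_zero (fun _ => dist_nonneg) (fun k => ?_) hreal
  have hf : Integrable f μ := f.integrable μ
  have hm : MeasurableSet (symmDiff (R k) A) := (hR k).symmDiff hA
  rw [dist_eq_norm, ← integral_indicator hA,
    ← integral_sub (hf.indicator (hR k)) (hf.indicator hA)]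
  have hb : ∀ x, ‖(R k).indicator f x - A.indicator f x‖ ≤
      (symmDiff (R k) A).indicator (fun _ => ‖f‖) x := fun x => by
    have := f.norm_coe_le_norm x
    rw [Real.norm_eq_abs] at this
    by_cases h1 : x ∈ R k <;> by_cases h2 : x ∈ A <;>
      simp [h1, h2, Set.indicator, Set.mem_symmDiff, this]
  refine (norm_integral_le_of_norm_le ((integrable_const _).indicator hm)
    (Eventually.of_forall hb)).trans_eq ?_
  rw [integral_indicator hm]
  simp [mul_comm]

theorem uniformMeasure_apply {d : ℕ} {M : Set (Euc d)} (hM : MeasurableSet M) (S : Set (Euc d)) :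
    (uniformMeasure M : Measure (Euc d)) S = (volume M)⁻¹ * volume (M ∩ S) :=
  cond_apply hM volume S

/-- The proportion of grid cells that meet the boundary of sets whose reach is at least `ρ n` tends
to zero, for grids with about `n ^ (1/8)` cells. -/
theorem tendsto_card_gridMeeting_frontier {d b : ℕ} [NeZero d] (hb : 16 * d < b) {r ρ : ℕ → ℝ}
    (hr_pos : ∀ n, 0 < r n) (hρ_pos : ∀ n, 0 < ρ n) (hr_lim : Tendsto r atTop (𝓝 0))
    (hρ_rate : ∀ α : ℝ, 0 < α →
      Tendsto (fun n : ℕ => (n : ℝ) * r n ^ (2 * d + 1) * ρ n ^ α) atTop atTop)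
    {R : ℕ → Set (Euc d)} (hR : ∀ n, IsOpen (R n))
    (hreach : ∀ n, ENNReal.ofReal (ρ n) ≤ reach (frontier (R n))) :
    Tendsto (fun n => ((gridMeeting b (Nat.log (b ^ (8 * d)) n) (frontier (R n))).card : ℝ) *
      (((b : ℝ) ^ Nat.log (b ^ (8 * d)) n) ^ d)⁻¹) atTop (𝓝 0) := by
  have hd : 0 < d := Nat.pos_of_ne_zero (NeZero.ne d)
  have hb0 : 0 < b := by omega
  have hbR : (0 : ℝ) < b := by exact_mod_cast hb0
  have hB : 1 < b ^ (8 * d) := Nat.one_lt_pow (by omega) (by omega)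
  have hq0 : (0 : ℝ) ≤ 1 - ((b : ℝ) ^ d)⁻¹ := by
    rw [sub_nonneg]
    exact inv_le_one_of_one_le₀ (one_le_pow₀ (by exact_mod_cast hb0))
  have hq1 : 1 - ((b : ℝ) ^ d)⁻¹ < 1 := by
    have : (0 : ℝ) < ((b : ℝ) ^ d)⁻¹ := by positivity
    linarith
  rw [Metric.tendsto_nhds]
  intro ε hε
  obtain ⟨j, hj⟩ := exists_pow_lt_of_lt_one hε hq1
  -- The decay is started `j` levels above the final grid, where the side is still at most `ρ n`;
  -- those `j` refinements yield the factor `(1 - b⁻ᵈ) ^ j < ε`.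
  filter_upwards [eventually_inv_pow_log_le (by omega : 1 < b) hr_pos hρ_pos hr_lim hρ_rate j,
    (tendsto_nat_log_atTop hB).eventually_ge_atTop j] with n hn hjn
  have hlt : ENNReal.ofReal (((b : ℝ) ^ (Nat.log (b ^ (8 * d)) n - j))⁻¹ / 4) <
      reach (frontier (R n)) := by
    refine lt_of_lt_of_le ((ENNReal.ofReal_lt_ofReal_iff (hρ_pos n)).2 ?_) (hreach n)
    have := hρ_pos n
    linarith
  have h := card_gridMeeting_le hb isClosed_frontier
    (by rw [← frontier_compl]; exact interior_frontier (hR n).isClosed_compl) hlt j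
  rw [Nat.sub_add_cancel hjn] at h
  rw [dist_zero_right, Real.norm_of_nonneg (by positivity)]
  refine lt_of_le_of_lt ?_ hj
  rwa [← div_eq_mul_inv, div_le_iff₀ (by positivity)]

theorem theorem3 (d : ℕ) [NeZero d]
    -- the domain
    (M : Set (Euc d)) (hM_open : IsOpen M) (hM_conn : IsConnected M)
    (hM_smooth : HasSmoothBoundary M) (hM_cube : M ⊆ openCube d)
    -- the i.i.d. uniform sample
    {Ω : Type*} [MeasurableSpace Ω] (P : Measure Ω) [IsProbabilityMeasure P]
    (X : ℕ → Ω → Euc d) (hX_meas : ∀ i, Measurable (X i)) (hX_indep : iIndepFun X P)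
    (hX_law : ∀ i, P.map (X i) = (uniformMeasure M : Measure (Euc d)))
    -- the radii
    (r ρ : ℕ → ℝ) (hr_pos : ∀ n, 0 < r n) (hρ_pos : ∀ n, 0 < ρ n)
    (hr_lim : Tendsto r atTop (𝓝 0))
    (hr_rate : Tendsto (fun n : ℕ => (n : ℝ) * r n ^ (2 * d + 1)) atTop atTop)
    (hρ_lim : Tendsto ρ atTop (𝓝 0))
    (hρ_slow : ∀ α : ℝ, 0 < α → r =o[atTop] (fun n => ρ n ^ α))
    (hρ_rate : ∀ α : ℝ, 0 < α →
      Tendsto (fun n : ℕ => (n : ℝ) * r n ^ (2 * d + 1) * ρ n ^ α) atTop atTop)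
    -- the classes of sets over which the functional is minimized
    (𝓡 : ℕ → Set (Set (Euc d)))
    (h𝓡 : ∀ n, ∀ R ∈ 𝓡 n,
      IsOpen R ∧ R ⊆ openCube d ∧ ENNReal.ofReal (ρ n) ≤ reach (frontier R))
    -- the (random) minimizing sequence
    (R : ℕ → Ω → Set (Euc d))
    (hR : ∀ᵐ ω ∂P, ∀ n, R n ω ∈ 𝓡 n ∧ ∀ S ∈ 𝓡 n,
      penalizedCut (fun i : Fin n => X i ω) (r n) (ρ n) (R n ω) ≤
        penalizedCut (fun i : Fin n => X i ω) (r n) (ρ n) S) :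
    -- almost surely, along each `L¹`-convergent subsequence the discrete measures converge weakly
    ∀ᵐ ω ∂P, ∀ φ : ℕ → ℕ, StrictMono φ → ∀ A : Set (Euc d), MeasurableSet A →
      Tendsto (fun k => volume (symmDiff (R (φ k) ω ∩ M) A)) atTop (𝓝 0) →
      Tendsto (fun k => discreteMeasure (fun i : Fin (φ k) => X i ω) (R (φ k) ω)) atTop
        (𝓝 ((uniformMeasure M).restrict A)) := by
  have hd : 0 < d := Nat.pos_of_ne_zero (NeZero.ne d)
  obtain ⟨b, hb⟩ : ∃ b, 16 * d < b := ⟨_, Nat.lt_succ_self _⟩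
  have hb1 : 1 < b := by omega
  have hB : 1 < b ^ (8 * d) := Nat.one_lt_pow (by omega) hb1
  have hM_meas : MeasurableSet M := hM_open.measurableSet
  set μ : Measure (Euc d) := (uniformMeasure M : Measure (Euc d)) with hμ
  have : IsProbabilityMeasure μ := by
    rw [← hX_law 0]
    exact Measure.isProbabilityMeasure_map (hX_meas 0).aemeasurable
  have hvM : volume M ≠ 0 := (hM_open.measure_pos volume hM_conn.nonempty).ne'
  have hμM : ∀ᵐ x ∂μ, x ∈ M := ae_cond_mem hM_meas
  set m : ℕ → ℕ := Nat.log (b ^ (8 * d)) with hm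
  have hmlim : Tendsto m atTop atTop := tendsto_nat_log_atTop hB
  set K : ℕ → ℕ := fun n => (b ^ m n) ^ d with hK
  have hK0 : ∀ n, 0 < K n := fun n => by positivity
  have hK8 : ∀ n, n ≠ 0 → K n ^ 8 ≤ n := fun n hn => by
    calc K n ^ 8 = (b ^ (8 * d)) ^ m n := by
          simp only [hK, ← pow_mul]; congr 1; ring
      _ ≤ n := Nat.pow_log_le_self _ hn
  -- The tolerance is small enough that the errors over all `K n` cells sum to `1 / K n → 0`, yet
  -- large enough for Hoeffding's bounds to be summable.
  set t : ℕ → ℝ := fun n => ((K n : ℝ) ^ 2)⁻¹ with ht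
  -- This event involves only the sample and the grid, not the sets `R n ω`, the test function or
  -- the subsequence; no measurability in `ω` of the sets is needed.
  have hconc := ae_eventually_forall_abs_empiricalMeasure_sub_lt hX_meas hX_indep hX_law
    (s := fun n => gridIndices d b (m n)) (C := fun n => gridCell b (m n))
    (fun n z => measurableSet_gridCell b (m n) z) (t := t) (fun n => by positivity)
    (by simp only [card_gridIndices]; exact summable_mul_exp_of_pow_le hK0 hK8)
  have hXM : ∀ᵐ ω ∂P, ∀ i, X i ω ∈ M := by
    refine ae_all_iff.2 fun i => ?_
    refine ae_of_ae_map (hX_meas i).aemeasurable ?_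
    rw [hX_law i]
    exact hμM
  filter_upwards [hconc, hXM, hR] with ω hcω hXω hRω φ hφ A hA hlim
  have hRo : ∀ n, IsOpen (R n ω) := fun n => (h𝓡 n _ (hRω n).1).1
  rw [FiniteMeasure.tendsto_iff_forall_integral_tendsto]
  intro f
  have hcell : ∀ m z, μ.real (gridCell b m z) ≤
      ((volume M)⁻¹).toReal * (((b : ℝ) ^ m) ^ d)⁻¹ := fun m z => by
    rw [measureReal_def, hμ, uniformMeasure_apply hM_meas, ENNReal.toReal_mul]
    refine mul_le_mul_of_nonneg_left ?_ ENNReal.toReal_nonneg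
    refine ENNReal.toReal_le_of_le_ofReal (by positivity)
      ((measure_mono Set.inter_subset_right).trans_eq ?_)
    rw [volume_gridCell (by omega), inv_pow]
  have hKtop : Tendsto (fun n => (K n : ℝ)) atTop atTop := by
    simp only [hK, Nat.cast_pow]
    exact (tendsto_pow_atTop hd.ne').comp
      ((tendsto_pow_atTop_atTop_of_one_lt (by exact_mod_cast hb1)).comp hmlim)
  have hdiff := tendsto_integral_indicator_sub hb1 (μ := μ)
    (ν := fun n => empiricalMeasure fun i : Fin n => X i ω)
    ((eventually_ne_atTop 0).mono fun n hn => isProbabilityMeasure_empiricalMeasure hn _)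
    (hμM.mono fun x hx => hM_cube hx)
    (fun n => (ae_empiricalMeasure_mem hM_meas fun i => hXω i).mono fun x hx => hM_cube hx)
    hmlim hcell hcω
    (by
      refine hKtop.inv_tendsto_atTop.congr fun n => ?_
      have := (Nat.cast_pos (α := ℝ)).2 (hK0 n)
      have h : ((b : ℝ) ^ m n) ^ d = K n := by simp [hK]
      rw [h, ht]
      simp only [Pi.inv_apply]
      field_simp)
    hRo
    (tendsto_card_gridMeeting_frontier hb hr_pos hρ_pos hr_lim hρ_rate hRo
      fun n => (h𝓡 n _ (hRω n).1).2.2) f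
  -- Since `μ` lives on `M`, it suffices that the part in `M` of the symmetric difference with `R (φ
  -- k) ω` lies in the one with `R (φ k) ω ∩ M`.
  have hsymm : Tendsto (fun k => μ (symmDiff (R (φ k) ω) A)) atTop (𝓝 0) := by
    have h0 := ENNReal.Tendsto.const_mul hlim (a := (volume M)⁻¹)
      (Or.inr (ENNReal.inv_ne_top.2 hvM))
    rw [mul_zero] at h0
    refine tendsto_of_tendsto_of_tendsto_of_le_of_le tendsto_const_nhds h0 (fun _ => zero_le)
      fun k => ?_
    rw [hμ, uniformMeasure_apply hM_meas]
    gcongr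
    intro x hx
    simp only [Set.mem_inter_iff, Set.mem_symmDiff] at hx ⊢
    tauto
  have hset := tendsto_setIntegral_of_tendsto_symmDiff (fun k => (hRo (φ k)).measurableSet) hA
    hsymm f
  have hadd := (hdiff.comp hφ.tendsto_atTop).add hset
  rw [zero_add] at hadd
  rw [FiniteMeasure.restrict_measure_eq]
  refine hadd.congr fun k => ?_
  rw [integral_discreteMeasure _ (hRo (φ k)).measurableSet]
  simp
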